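/- There is an absolute constant $C > 0$ such that the following holds. Let $G$ be a vector space over $\mathbb{F}_2$, let $K$ be a real number, and let $A \subset G$ be a non-empty finite set with $|A+A| \leq K|A|$, where $A+A = \{a+b : a, b \in A\}$. Then $A$ is contained in a coset $x+V$ of a finite subspace $V$ of $G$ with $$|x+V| \leq 2^{C K^{3/2}\log K}\,|A|.$$ -/

import Mathlib

open scoped Pointwise

universe u

open Finset
open scoped symmDiff FinsetFamily

/-! ### Down-compression and symmetric differences -/

section Compression
variable {α : Type*} [DecidableEq α]

/-! Translate `A` to contain 0 and choose a basis of its span from `A` itself. In coordinates `A`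
becomes a family of finite sets containing `∅` and all singletons, and addition becomes symmetric
difference. Compression makes this family a lower set without increasing the doubling
(`exists_isLowerSet_card_image₂_symmDiff_le`).

For a lower set, few coordinates are rare (`card_le_two_mul_of_forall_lt`). On the set `J` of the
others, each lying in a proportion at least `p` of the members, Shearer's inequality for the sets `J
\ S` yields a member `S` for which the density `δ` on `J` rises to at least `δ ^ (1 - p)` on `J \
S`. Adding subsets of `S ∩ J` to members inside `J \ S` gives at least `2 ^ #J * δ ^ (1 - p)`
distinct sums (`pow_card_mul_densityOn_rpow_le`), and small doubling then bounds `δ` below. With `p`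
of order `1 / K` the span has size at most `K ^ (16 * K) * #A`, which is stronger than required. -/

lemma mem_downCompression_iff_ite {a : α} {𝒜 : Finset (Finset α)} {s : Finset α} :
    s ∈ 𝓓 a 𝒜 ↔ if a ∈ s then s ∈ 𝒜 ∧ s.erase a ∈ 𝒜 else s ∈ 𝒜 ∨ insert a s ∈ 𝒜 := by
  rw [Down.mem_compression]
  split_ifs with h
  · rw [insert_eq_of_mem h]; tauto
  · rw [erase_eq_of_notMem h]; tauto

/-- Moving `a` in or out of one summand moves it in or out of the symmetric difference, and moving
it in both changes nothing; so the sets required on the right arise from pairs in `𝒜`. -/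
lemma image₂_symmDiff_downCompression_subset (a : α) (𝒜 : Finset (Finset α)) :
    image₂ (· ∆ ·) (𝓓 a 𝒜) (𝓓 a 𝒜) ⊆ 𝓓 a (image₂ (· ∆ ·) 𝒜 𝒜) := by
  have key : ∀ s ∈ 𝒜, ∀ t ∈ 𝒜, s ∆ t ∈ image₂ (· ∆ ·) 𝒜 𝒜 :=
    fun s hs t ht => mem_image₂_of_mem hs ht
  intro u hu
  obtain ⟨s, hs, t, ht, rfl⟩ := mem_image₂.1 hu
  simp only [mem_downCompression_iff_ite] at hs ht ⊢
  by_cases has : a ∈ s <;> by_cases hat : a ∈ t <;>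
    simp only [has, hat, if_true, if_false, mem_symmDiff, not_true, not_false_iff, and_true,
      and_false, or_false, false_or, and_self] at hs ht ⊢
  · exact Or.inl (key _ hs.1 _ ht.1)
  · have e1 : s ∆ t = (s.erase a) ∆ (insert a t) := by ext x; simp only [mem_symmDiff]; grind
    have e2 : (s ∆ t).erase a = s ∆ (insert a t) := by ext x; simp only [mem_symmDiff, mem_erase]; grind
    have e3 : (s ∆ t).erase a = (s.erase a) ∆ t := by ext x; simp only [mem_symmDiff, mem_erase]; grind
    rcases ht with ht | ht
    · exact ⟨key _ hs.1 _ ht, e3 ▸ key _ hs.2 _ ht⟩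
    · exact ⟨e1 ▸ key _ hs.2 _ ht, e2 ▸ key _ hs.1 _ ht⟩
  · have e1 : s ∆ t = (insert a s) ∆ (t.erase a) := by ext x; simp only [mem_symmDiff]; grind
    have e2 : (s ∆ t).erase a = (insert a s) ∆ t := by ext x; simp only [mem_symmDiff, mem_erase]; grind
    have e3 : (s ∆ t).erase a = s ∆ (t.erase a) := by ext x; simp only [mem_symmDiff, mem_erase]; grind
    rcases hs with hs | hs
    · exact ⟨key _ hs _ ht.1, e3 ▸ key _ hs _ ht.2⟩
    · exact ⟨e1 ▸ key _ hs _ ht.2, e2 ▸ key _ hs _ ht.1⟩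
  · have e1 : s ∆ t = (insert a s) ∆ (insert a t) := by ext x; simp only [mem_symmDiff]; grind
    have e2 : insert a (s ∆ t) = (insert a s) ∆ t := by ext x; simp only [mem_symmDiff, mem_insert]; grind
    have e3 : insert a (s ∆ t) = s ∆ (insert a t) := by ext x; simp only [mem_symmDiff, mem_insert]; grind
    rcases hs with hs | hs <;> rcases ht with ht | ht
    · exact Or.inl (key _ hs _ ht)
    · exact Or.inr (e3 ▸ key _ hs _ ht)
    · exact Or.inr (e2 ▸ key _ hs _ ht)
    · exact Or.inl (e1 ▸ key _ hs _ ht)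

lemma card_image₂_symmDiff_downCompression_le (a : α) (𝒜 : Finset (Finset α)) :
    #(image₂ (· ∆ ·) (𝓓 a 𝒜) (𝓓 a 𝒜)) ≤ #(image₂ (· ∆ ·) 𝒜 𝒜) :=
  (card_le_card (image₂_symmDiff_downCompression_subset a 𝒜)).trans_eq (Down.card_compression _ _)

/-- Later compressions do not undo earlier ones, so one pass over the coordinates suffices. -/
lemma erase_mem_downCompression {a b : α} {𝒜 : Finset (Finset α)}
    (h : ∀ s ∈ 𝒜, s.erase b ∈ 𝒜) : ∀ s ∈ 𝓓 a 𝒜, s.erase b ∈ 𝓓 a 𝒜 := by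
  intro s hs
  obtain rfl | hab := eq_or_ne a b
  · exact Down.erase_mem_compression_of_mem_compression hs
  simp only [mem_downCompression_iff_ite, mem_erase, hab, ne_eq, not_false_eq_true,
    true_and] at hs ⊢
  split_ifs at hs ⊢
  · exact ⟨h _ hs.1, by rw [erase_right_comm]; exact h _ hs.2⟩
  · rw [← erase_insert_of_ne hab]
    exact hs.imp (h _) (h _)

/-- Compressing in every direction turns a family containing `∅` and all singletons into a lower
set of the same size, without increasing the size of the family of symmetric differences. -/
lemma exists_isLowerSet_card_image₂_symmDiff_le [Fintype α] (𝒜 : Finset (Finset α))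
    (h0 : ∅ ∈ 𝒜) (h1 : ∀ i, {i} ∈ 𝒜) :
    ∃ ℬ : Finset (Finset α), IsLowerSet (ℬ : Set (Finset α)) ∧ ∅ ∈ ℬ ∧ (∀ i, {i} ∈ ℬ) ∧
      #ℬ = #𝒜 ∧ #(image₂ (· ∆ ·) ℬ ℬ) ≤ #(image₂ (· ∆ ·) 𝒜 𝒜) := by
  have main : ∀ V : Finset α, ∃ ℬ : Finset (Finset α),
      (∀ b ∈ V, ∀ s ∈ ℬ, s.erase b ∈ ℬ) ∧ ∅ ∈ ℬ ∧ (∀ i, {i} ∈ ℬ) ∧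
      #ℬ = #𝒜 ∧ #(image₂ (· ∆ ·) ℬ ℬ) ≤ #(image₂ (· ∆ ·) 𝒜 𝒜) := by
    intro V
    induction V using Finset.induction with
    | empty => exact ⟨𝒜, by simp, h0, h1, rfl, le_rfl⟩
    | insert a V _ ih =>
      obtain ⟨ℬ, hV, h0, h1, hc, h2⟩ := ih
      refine ⟨𝓓 a ℬ, ?_, ?_, ?_, (Down.card_compression _ _).trans hc,
        (card_image₂_symmDiff_downCompression_le a ℬ).trans h2⟩
      · intro b hb
        rcases mem_insert.1 hb with rfl | hb
        · exact fun s hs => Down.erase_mem_compression_of_mem_compression hs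
        · exact erase_mem_downCompression (hV b hb)
      · simp [mem_downCompression_iff_ite, h0]
      · intro i
        rw [mem_downCompression_iff_ite]
        split_ifs with h
        · obtain rfl := mem_singleton.1 h
          exact ⟨h1 _, by simpa using h0⟩
        · exact Or.inl (h1 i)
  obtain ⟨ℬ, hV, h⟩ := main univ
  refine ⟨ℬ, ?_, h⟩
  have hsd : ∀ (u s : Finset α), s ∈ ℬ → s \ u ∈ ℬ := by
    intro u s hs
    induction u using Finset.induction with
    | empty => simpa using hs
    | insert a u _ ih => rw [sdiff_insert]; exact hV a (mem_univ _) _ ih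
  intro s t hts hs
  have := hsd (s \ t) s hs
  rwa [Finset.sdiff_sdiff_eq_self hts] at this

end Compression

/-! ### Shearer's inequality for densities of lower sets -/

section Shearer

/-- Weighted AM-GM where the weights `1 / k` are completed to total mass one. -/
lemma prod_rpow_inv_le_sum {ι : Type*} (M : Finset ι) (t : ι → ℝ) (ht : ∀ j ∈ M, 0 ≤ t j)
    (k : ℝ) (hk : 0 < k) (hM : (#M : ℝ) ≤ k) :
    ∏ j ∈ M, t j ^ k⁻¹ ≤ k⁻¹ * ∑ j ∈ M, t j + (1 - #M * k⁻¹) := by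
  have hk' : 0 ≤ k⁻¹ := by positivity
  have hM' : #M * k⁻¹ ≤ 1 := by rw [← div_eq_mul_inv]; exact (div_le_one hk).2 hM
  have := Real.geom_mean_le_arith_mean_weighted (insertNone M)
    (fun o => o.elim (1 - #M * k⁻¹) (fun _ => k⁻¹)) (fun o => o.elim 1 t)
    (by rintro (_ | j) _ <;> simp [hk', hM']) (by simp)
    (by rintro (_ | j) hj
        · simp
        · exact ht j (by simpa using hj))
  simp only [prod_insertNone, sum_insertNone, Option.elim, Real.one_rpow, one_mul, mul_one,
    ← mul_sum] at this
  linarith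

/-- Concavity of the geometric mean: apply AM-GM to the ratios of `x j` and of `y j` to their
average; the two bounds add up to 2. `P` carries the factors common to both halves in the Shearer
induction. -/
lemma rpow_half_add_le_mul_prod {ι : Type*} (M : Finset ι) (x y : ι → ℝ)
    (hx : ∀ j ∈ M, 0 < x j) (hy : ∀ j ∈ M, 0 ≤ y j) (P k a b : ℝ) (hP : 0 < P) (hk : 0 < k)
    (hM : (#M : ℝ) ≤ k) (ha : 0 ≤ a) (hb : 0 ≤ b) (hax : a ^ k ≤ P * ∏ j ∈ M, x j)
    (hby : b ^ k ≤ P * ∏ j ∈ M, y j) :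
    ((a + b) / 2) ^ k ≤ P * ∏ j ∈ M, (x j + y j) / 2 := by
  have hz : ∀ j ∈ M, 0 < (x j + y j) / 2 := fun j hj => by
    have := hx j hj; have := hy j hj; positivity
  set Q := P * ∏ j ∈ M, (x j + y j) / 2 with hQ
  have hQ0 : 0 < Q := mul_pos hP (prod_pos hz)
  set R := Q ^ k⁻¹ with hR
  have hR0 : 0 < R := Real.rpow_pos_of_pos hQ0 _
  have key : ∀ (c : ℝ) (u : ι → ℝ), 0 ≤ c → (∀ j ∈ M, 0 ≤ u j) → c ^ k ≤ P * ∏ j ∈ M, u j →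
      c ≤ R * (k⁻¹ * ∑ j ∈ M, u j / ((x j + y j) / 2) + (1 - #M * k⁻¹)) := by
    intro c u hc hu hcu
    have ht : ∀ j ∈ M, 0 ≤ u j / ((x j + y j) / 2) := fun j hj => div_nonneg (hu j hj) (hz j hj).le
    refine le_trans ?_ (mul_le_mul_of_nonneg_left (prod_rpow_inv_le_sum M _ ht k hk hM) hR0.le)
    rw [Real.finsetProd_rpow _ _ ht, hR, ← Real.mul_rpow hQ0.le (prod_nonneg ht), prod_div_distrib]
    have : Q * ((∏ j ∈ M, u j) / ∏ j ∈ M, (x j + y j) / 2) = P * ∏ j ∈ M, u j := by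
      have := (prod_pos hz).ne'
      rw [hQ]; field_simp
    rw [this]
    exact (Real.le_rpow_inv_iff_of_pos hc (le_trans (by positivity) hcu) hk).2 hcu
  have h1 := key a x ha (fun j hj => (hx j hj).le) hax
  have h2 := key b y hb hy hby
  have hsum : ∑ j ∈ M, x j / ((x j + y j) / 2) + ∑ j ∈ M, y j / ((x j + y j) / 2) = 2 * #M := by
    rw [← sum_add_distrib, mul_comm, ← nsmul_eq_mul, ← sum_const]
    refine sum_congr rfl fun j hj => ?_
    have := (hz j hj).ne'
    have : x j + y j ≠ 0 := fun h => this (by simp [h])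
    field_simp
  have h3 : (a + b) / 2 ≤ R := by
    have : a + b ≤ R * (k⁻¹ * (2 * #M) + 2 * (1 - #M * k⁻¹)) := by
      rw [← hsum]; linarith
    linarith
  calc ((a + b) / 2) ^ k ≤ R ^ k := Real.rpow_le_rpow (by positivity) h3 hk.le
    _ = Q := Real.rpow_inv_rpow hQ0.le hk.ne'

variable {α : Type*} [DecidableEq α]

/-- The proportion of subsets of `W` that belong to `𝒜`. -/
noncomputable def densityOn (𝒜 : Finset (Finset α)) (W : Finset α) : ℝ :=
  #{s ∈ 𝒜 | s ⊆ W} / 2 ^ #W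

lemma densityOn_nonneg (𝒜 : Finset (Finset α)) (W : Finset α) : 0 ≤ densityOn 𝒜 W := by
  unfold densityOn; positivity

lemma densityOn_pos {𝒜 : Finset (Finset α)} (h : ∅ ∈ 𝒜) (W : Finset α) : 0 < densityOn 𝒜 W := by
  have : 0 < #{s ∈ 𝒜 | s ⊆ W} := card_pos.2 ⟨∅, by simp [h]⟩
  unfold densityOn; positivity

lemma densityOn_empty {𝒜 : Finset (Finset α)} (h : ∅ ∈ 𝒜) : densityOn 𝒜 ∅ = 1 := by
  have : ({s ∈ 𝒜 | s ⊆ ∅} : Finset (Finset α)) = {∅} := by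
    ext s; simp only [mem_filter, subset_empty, mem_singleton]; grind
  rw [densityOn, this]
  simp

lemma densityOn_mono {𝒜 ℬ : Finset (Finset α)} (h : 𝒜 ⊆ ℬ) (W : Finset α) :
    densityOn 𝒜 W ≤ densityOn ℬ W := by
  unfold densityOn
  gcongr

lemma densityOn_of_notMem {a : α} {𝒜 : Finset (Finset α)} {W : Finset α} (ha : a ∉ W) :
    densityOn 𝒜 W = densityOn (𝒜.nonMemberSubfamily a) W := by
  unfold densityOn
  congr 3
  ext s
  simp only [mem_filter, mem_nonMemberSubfamily]
  grind

lemma densityOn_of_mem {a : α} {𝒜 : Finset (Finset α)} {W : Finset α} (ha : a ∈ W) :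
    densityOn 𝒜 W = (densityOn (𝒜.nonMemberSubfamily a) (W.erase a) +
      densityOn (𝒜.memberSubfamily a) (W.erase a)) / 2 := by
  unfold densityOn
  have h1 : {s ∈ 𝒜.nonMemberSubfamily a | s ⊆ W.erase a} =
      ({s ∈ 𝒜 | s ⊆ W} : Finset (Finset α)).nonMemberSubfamily a := by
    ext s
    simp only [mem_filter, mem_nonMemberSubfamily, subset_erase]
    tauto
  have h2 : {s ∈ 𝒜.memberSubfamily a | s ⊆ W.erase a} =
      ({s ∈ 𝒜 | s ⊆ W} : Finset (Finset α)).memberSubfamily a := by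
    ext s
    simp only [mem_filter, mem_memberSubfamily, subset_erase, insert_subset_iff, ha]
    tauto
  rw [h1, h2, ← card_memberSubfamily_add_card_nonMemberSubfamily a {s ∈ 𝒜 | s ⊆ W},
    ← card_erase_add_one ha, pow_succ]
  push_cast
  field_simp
  ring

/-- Induction on `V`, splitting the family at `a`. A factor with `a ∉ W j` sees only `𝒜₀`, which
contains `𝒜₁`, so it may be used for both halves. -/
lemma densityOn_rpow_le_prod_of_pos {ι : Type*} (V : Finset α) (k : ℝ) (hk : 0 < k) (J : Finset ι) :
    ∀ (𝒜 : Finset (Finset α)), IsLowerSet (𝒜 : Set (Finset α)) → ∅ ∈ 𝒜 →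
    ∀ W : ι → Finset α, (∀ j ∈ J, W j ⊆ V) → (∀ i ∈ V, (#{j ∈ J | i ∈ W j} : ℝ) ≤ k) →
      densityOn 𝒜 V ^ k ≤ ∏ j ∈ J, densityOn 𝒜 (W j) := by
  induction V using Finset.induction with
  | empty =>
    intro 𝒜 _ h0 W hW _
    have h := densityOn_empty h0
    rw [h, Real.one_rpow, prod_congr rfl fun j hj => by rw [subset_empty.1 (hW j hj), h]]
    simp
  | insert a V haV ih =>
    intro 𝒜 hl h0 W hW hd
    set 𝒜₀ := 𝒜.nonMemberSubfamily a
    set 𝒜₁ := 𝒜.memberSubfamily a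
    have h00 : ∅ ∈ 𝒜₀ := by simp [𝒜₀, h0]
    have hl0 : IsLowerSet (𝒜₀ : Set (Finset α)) := by
      intro s t hts hs
      simp only [𝒜₀, mem_coe, mem_nonMemberSubfamily] at hs ⊢
      exact ⟨hl hts hs.1, fun h => hs.2 (hts h)⟩
    have hl1 : IsLowerSet (𝒜₁ : Set (Finset α)) := by
      intro s t hts hs
      simp only [𝒜₁, mem_coe, mem_memberSubfamily] at hs ⊢
      exact ⟨hl (insert_subset_insert a hts) hs.1, fun h => hs.2 (hts h)⟩
    have h10 : 𝒜₁ ⊆ 𝒜₀ := by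
      intro s hs
      simp only [𝒜₀, 𝒜₁, mem_nonMemberSubfamily, mem_memberSubfamily] at hs ⊢
      exact ⟨hl (subset_insert a s) hs.1, hs.2⟩
    have hW' : ∀ j ∈ J, (W j).erase a ⊆ V := fun j hj => by
      rw [← erase_insert haV]; exact erase_subset_erase _ (hW j hj)
    have hd' : ∀ i ∈ V, (#{j ∈ J | i ∈ (W j).erase a} : ℝ) ≤ k := fun i hi => by
      refine le_trans ?_ (hd i (mem_insert_of_mem hi))
      gcongr
      exact erase_subset _ _
    have i0 := ih 𝒜₀ hl0 h00 _ hW' hd'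
    have i1 : densityOn 𝒜₁ V ^ k ≤ ∏ j ∈ J, densityOn 𝒜₁ ((W j).erase a) := by
      by_cases h : ∅ ∈ 𝒜₁
      · exact ih 𝒜₁ hl1 h _ hW' hd'
      · have : 𝒜₁ = ∅ := by
          by_contra hne
          obtain ⟨s, hs⟩ := nonempty_iff_ne_empty.2 hne
          exact h (hl1 (empty_subset s) hs)
        rw [show densityOn 𝒜₁ V = 0 by simp [densityOn, this], Real.zero_rpow hk.ne']
        exact prod_nonneg fun _ _ => densityOn_nonneg _ _
    rw [densityOn_of_mem (mem_insert_self a V), erase_insert haV]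
    rw [← prod_filter_not_mul_prod_filter J (fun j => a ∈ W j)] at i0 i1 ⊢
    rw [prod_congr rfl (g := fun j => densityOn 𝒜₀ ((W j).erase a)) (s₁ := {j ∈ J | ¬ a ∈ W j})
        fun j hj => by
          rw [densityOn_of_notMem (mem_filter.1 hj).2, erase_eq_of_notMem (mem_filter.1 hj).2],
      prod_congr rfl (s₁ := {j ∈ J | a ∈ W j}) fun j hj => densityOn_of_mem (mem_filter.1 hj).2]
    refine rpow_half_add_le_mul_prod _ (fun j => densityOn 𝒜₀ ((W j).erase a))
      (fun j => densityOn 𝒜₁ ((W j).erase a)) (fun _ _ => densityOn_pos h00 _)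
      (fun _ _ => densityOn_nonneg _ _) _ k _ _ (prod_pos fun _ _ => densityOn_pos h00 _) hk
      (hd a (mem_insert_self _ _)) (densityOn_nonneg _ _) (densityOn_nonneg _ _) i0
      (i1.trans ?_)
    refine mul_le_mul_of_nonneg_right (prod_le_prod (fun _ _ => densityOn_nonneg _ _)
      fun _ _ => densityOn_mono h10 _) (prod_nonneg fun _ _ => densityOn_nonneg _ _)

/-- A form of Shearer's inequality for lower sets. -/
lemma densityOn_rpow_le_prod {ι : Type*} (V : Finset α) (k : ℝ) (hk : 0 ≤ k) (J : Finset ι)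
    (𝒜 : Finset (Finset α)) (hl : IsLowerSet (𝒜 : Set (Finset α))) (h0 : ∅ ∈ 𝒜)
    (W : ι → Finset α) (hW : ∀ j ∈ J, W j ⊆ V) (hd : ∀ i ∈ V, (#{j ∈ J | i ∈ W j} : ℝ) ≤ k) :
    densityOn 𝒜 V ^ k ≤ ∏ j ∈ J, densityOn 𝒜 (W j) := by
  obtain rfl | hk := hk.eq_or_lt
  · have hW0 : ∀ j ∈ J, W j = ∅ := by
      intro j hj
      by_contra hne
      obtain ⟨i, hi⟩ := nonempty_iff_ne_empty.2 hne
      have h1 := hd i (hW j hj hi)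
      have h2 : 0 < #{j ∈ J | i ∈ W j} := card_pos.2 ⟨j, by simp [hj, hi]⟩
      have h3 : (0 : ℝ) < #{j ∈ J | i ∈ W j} := by exact_mod_cast h2
      linarith
    have h := densityOn_empty h0
    rw [Real.rpow_zero, prod_congr rfl fun j hj => by rw [hW0 j hj, h]]
    simp
  · exact densityOn_rpow_le_prod_of_pos V k hk J 𝒜 hl h0 W hW hd

end Shearer

/-! ### Lower sets of small doubling are dense -/

section LowerSet
variable {α : Type*} [DecidableEq α]

lemma pow_card_mul_card_filter_le {𝒜 : Finset (Finset α)} (hl : IsLowerSet (𝒜 : Set (Finset α)))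
    {S T : Finset α} (hS : S ∈ 𝒜) (hST : Disjoint S T) :
    2 ^ #S * #{s ∈ 𝒜 | s ⊆ T} ≤ #(image₂ (· ∆ ·) 𝒜 𝒜) := by
  rw [← card_powerset, ← card_product]
  refine card_le_card_of_injOn (fun p => p.1 ∆ p.2) ?_ ?_
  · rintro ⟨X, Y⟩ h
    simp only [coe_product, Set.mem_prod, mem_coe, mem_powerset, mem_filter] at h
    exact mem_coe.2 (mem_image₂_of_mem (hl h.1 hS) h.2.1)
  · rintro ⟨X, Y⟩ h ⟨X', Y'⟩ h' e
    simp only [coe_product, Set.mem_prod, mem_coe, mem_powerset, mem_filter] at h h' e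
    have e' : ∀ i, (i ∈ X ∆ Y ↔ i ∈ X' ∆ Y') := fun i => by rw [e]
    have hd : ∀ i, i ∈ S → i ∈ T → False := fun i => fun h1 h2 => (disjoint_left.1 hST) h1 h2
    simp only [mem_symmDiff] at e'
    obtain ⟨hX, -, hY⟩ := h
    obtain ⟨hX', -, hY'⟩ := h'
    ext i
    · have := e' i; have := hd i; have := @hX i; have := @hY i
      have := @hX' i; have := @hY' i; tauto
    · have := e' i; have := hd i; have := @hX i; have := @hY i
      have := @hX' i; have := @hY' i; tauto

/-- If every `i ∈ J` lies in a proportion at least `p` of the members of the lower set `𝒜`, then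
the density on `J` of the sumset exceeds that of `𝒜` by a power. -/
lemma pow_card_mul_densityOn_rpow_le {𝒜 : Finset (Finset α)}
    (hl : IsLowerSet (𝒜 : Set (Finset α))) (h0 : ∅ ∈ 𝒜) (J : Finset α) {p : ℝ} (hp : p ≤ 1)
    (hJ : ∀ i ∈ J, p * #𝒜 ≤ #{s ∈ 𝒜 | i ∈ s}) :
    2 ^ #J * densityOn 𝒜 J ^ (1 - p) ≤ #(image₂ (· ∆ ·) 𝒜 𝒜) := by
  have hN : (0 : ℝ) < #𝒜 := by exact_mod_cast card_pos.2 ⟨∅, h0⟩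
  have hβ := densityOn_pos h0 J
  -- The index set is `𝒜` itself: a point of `J` lies in `J \ S` for at most `(1 - p) * #𝒜` members
  -- `S`.
  have hsh := densityOn_rpow_le_prod J ((1 - p) * #𝒜) (mul_nonneg (by linarith) hN.le) 𝒜 𝒜 hl h0
    (fun S => J \ S) (fun _ _ => sdiff_subset) (by
      intro i hi
      have h1 : #{S ∈ 𝒜 | i ∈ J \ S} = #{S ∈ 𝒜 | ¬ i ∈ S} := by
        congr 1; ext S; simp [hi]
      have h2 := card_filter_add_card_filter_not (s := 𝒜) (fun S => i ∈ S)
      have h3 := hJ i hi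
      rw [h1]
      have h2' : (#{S ∈ 𝒜 | i ∈ S} : ℝ) + #{S ∈ 𝒜 | ¬ i ∈ S} = #𝒜 := by exact_mod_cast h2
      linarith)
  obtain ⟨S, hS, hle⟩ : ∃ S ∈ 𝒜, densityOn 𝒜 J ^ (1 - p) ≤ densityOn 𝒜 (J \ S) := by
    by_contra! hcon
    have := prod_lt_prod_of_nonempty (s := 𝒜) (f := fun S => densityOn 𝒜 (J \ S))
      (g := fun _ => densityOn 𝒜 J ^ (1 - p)) (fun _ _ => densityOn_pos h0 _) hcon ⟨∅, h0⟩
    rw [prod_const, ← Real.rpow_natCast, ← Real.rpow_mul hβ.le] at this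
    linarith
  have hcount := pow_card_mul_card_filter_le hl
    (hl (inter_subset_left : S ∩ J ⊆ S) hS : S ∩ J ∈ 𝒜) (T := J \ S)
    (disjoint_left.2 fun i h1 h2 => (mem_sdiff.1 h2).2 (mem_inter.1 h1).1)
  have hcard : #(S ∩ J) + #(J \ S) = #J := by rw [inter_comm]; exact card_inter_add_card_sdiff J S
  calc (2 : ℝ) ^ #J * densityOn 𝒜 J ^ (1 - p) ≤ 2 ^ #J * densityOn 𝒜 (J \ S) := by gcongr
    _ = 2 ^ #(S ∩ J) * #{s ∈ 𝒜 | s ⊆ J \ S} := by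
      rw [densityOn, ← hcard, pow_add]; field_simp
    _ ≤ _ := by exact_mod_cast hcount

/-- The proportion of members containing a given point is bounded below when the doubling is
less than two. -/
lemma two_mul_card_le_card_image₂_add {𝒜 : Finset (Finset α)} (h0 : ∅ ∈ 𝒜) {i : α}
    (h1 : {i} ∈ 𝒜) : 2 * #𝒜 ≤ #(image₂ (· ∆ ·) 𝒜 𝒜) + 2 * #{s ∈ 𝒜 | i ∈ s} := by
  have h2 := card_filter_add_card_filter_not (s := 𝒜) (fun S => i ∈ S)
  -- The members missing `i` and their translates by `{i}` are disjoint parts of the sumset.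
  suffices 2 * #{s ∈ 𝒜 | ¬ i ∈ s} ≤ #(image₂ (· ∆ ·) 𝒜 𝒜) by omega
  have hinj : Set.InjOn (insert i) (({s ∈ 𝒜 | ¬ i ∈ s} : Finset (Finset α)) : Set (Finset α)) := by
    intro s hs t ht e
    rw [mem_coe, mem_filter] at hs ht
    rw [← erase_insert hs.2, e, erase_insert ht.2]
  rw [two_mul]
  nth_rewrite 2 [← card_image_of_injOn hinj]
  rw [← card_union_of_disjoint]
  · refine card_le_card (union_subset ?_ ?_)
    · intro s hs
      refine mem_image₂.2 ⟨s, (mem_filter.1 hs).1, ∅, h0, by simp⟩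
    · intro s hs
      obtain ⟨t, ht, rfl⟩ := mem_image.1 hs
      refine mem_image₂.2 ⟨t, (mem_filter.1 ht).1, {i}, h1, ?_⟩
      have := (mem_filter.1 ht).2
      ext x; simp only [mem_symmDiff, mem_singleton, mem_insert]; grind
  · rw [disjoint_left]
    intro s hs hs'
    obtain ⟨t, _, rfl⟩ := mem_image.1 hs'
    exact (mem_filter.1 hs).2 (mem_insert_self _ _)

/-- If `S` misses `M` and `i ∈ M`, then `S ∆ {i}` meets `M` in `i` alone, so it determines the pair.
-/
lemma card_mul_card_filter_disjoint_le {𝒜 : Finset (Finset α)} (h1 : ∀ i, {i} ∈ 𝒜)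
    (M : Finset α) :
    #M * #{s ∈ 𝒜 | Disjoint s M} ≤ #(image₂ (· ∆ ·) 𝒜 𝒜) := by
  rw [← card_product]
  refine card_le_card_of_injOn (fun p => p.2 ∆ {p.1}) ?_ ?_
  · rintro ⟨i, S⟩ h
    simp only [coe_product, Set.mem_prod, mem_coe, mem_filter] at h
    exact mem_coe.2 (mem_image₂_of_mem h.2.1 (h1 i))
  · rintro ⟨i, S⟩ h ⟨i', S'⟩ h' e
    simp only [coe_product, Set.mem_prod, mem_coe, mem_filter] at h h' e
    have hi : i ∉ S := disjoint_right.1 h.2.2 h.1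
    have hi' : i ∉ S' := disjoint_right.1 h'.2.2 h.1
    have e1 := Finset.ext_iff.1 e i
    simp only [mem_symmDiff, mem_singleton, hi, hi'] at e1
    have : i = i' := by tauto
    subst this
    rw [symmDiff_left_inj] at e
    rw [e]

lemma card_le_card_filter_disjoint_add (𝒜 : Finset (Finset α)) (M : Finset α) :
    #𝒜 ≤ #{s ∈ 𝒜 | Disjoint s M} + ∑ i ∈ M, #{s ∈ 𝒜 | i ∈ s} := by
  rw [← card_filter_add_card_filter_not (s := 𝒜) (fun s => Disjoint s M)]
  gcongr
  refine le_trans (card_le_card ?_) card_biUnion_le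
  intro s hs
  obtain ⟨hs, hd⟩ := mem_filter.1 hs
  obtain ⟨i, his, hiM⟩ := not_disjoint_iff.1 hd
  exact mem_biUnion.2 ⟨i, hiM, by simp [hs, his]⟩

/-- Coordinates lying in few members of `𝒜` are bounded in number by the doubling. -/
lemma card_le_two_mul_of_forall_lt {𝒜 : Finset (Finset α)} (h1 : ∀ i, {i} ∈ 𝒜) {K : ℝ}
    (hK1 : 1 ≤ K) (hK : (#(image₂ (· ∆ ·) 𝒜 𝒜) : ℝ) ≤ K * #𝒜) (M : Finset α)
    (hM : ∀ i ∈ M, (#{s ∈ 𝒜 | i ∈ s} : ℝ) < (6 * K)⁻¹ * #𝒜) : (#M : ℝ) ≤ 2 * K := by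
  by_contra! hcon
  -- This size exceeds `2 * K` but is at most `3 * K`, so at least half the members avoid the chosen
  -- points, giving more than `K * #𝒜` sums.
  have hle : ⌊2 * K⌋₊ + 1 ≤ #M := by
    have := (Nat.floor_lt (by linarith)).2 hcon
    omega
  obtain ⟨M', hM', hcard⟩ := exists_subset_card_eq hle
  have hfl := Nat.floor_le (show 0 ≤ 2 * K by linarith)
  have hfl' := Nat.lt_floor_add_one (2 * K)
  have hcardR : (#M' : ℝ) = ⌊2 * K⌋₊ + 1 := by rw [hcard]; push_cast; ring
  obtain ⟨i, hi⟩ : M'.Nonempty := card_pos.1 (by omega)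
  have hN : (0 : ℝ) < #𝒜 := by exact_mod_cast card_pos.2 ⟨{i}, h1 i⟩
  have a1 : (#M' : ℝ) * #{s ∈ 𝒜 | Disjoint s M'} ≤ #(image₂ (· ∆ ·) 𝒜 𝒜) := by
    exact_mod_cast card_mul_card_filter_disjoint_le h1 M'
  have a2 : (#𝒜 : ℝ) ≤ #{s ∈ 𝒜 | Disjoint s M'} + ∑ i ∈ M', (#{s ∈ 𝒜 | i ∈ s} : ℝ) := by
    exact_mod_cast card_le_card_filter_disjoint_add 𝒜 M'
  have a3 : ∑ i ∈ M', (#{s ∈ 𝒜 | i ∈ s} : ℝ) ≤ #M' * ((6 * K)⁻¹ * #𝒜) := by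
    rw [← nsmul_eq_mul]
    exact sum_le_card_nsmul _ _ _ fun i hi => (hM i (hM' hi)).le
  have a4 : (#M' : ℝ) * ((6 * K)⁻¹ * #𝒜) ≤ #𝒜 / 2 := by
    have : (#M' : ℝ) * (6 * K)⁻¹ ≤ 1 / 2 := by
      rw [← div_eq_mul_inv, div_le_iff₀ (by linarith)]; linarith
    nlinarith
  have a5 : (#𝒜 : ℝ) / 2 ≤ #{s ∈ 𝒜 | Disjoint s M'} := by linarith
  have a6 : (2 * K) * (#𝒜 / 2) < #M' * #{s ∈ 𝒜 | Disjoint s M'} :=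
    lt_of_lt_of_le (mul_lt_mul_of_pos_right (by linarith) (by positivity))
      (mul_le_mul_of_nonneg_left a5 (by positivity))
  linarith

lemma le_rpow_of_mul_rpow_le {b p L : ℝ} (hb : 0 < b) (hp : 0 < p)
    (h : b ^ (1 - p) ≤ L * b) : 1 ≤ L ^ p⁻¹ * b := by
  have h1 : b ^ (-p) ≤ L := by
    rw [sub_eq_neg_add, Real.rpow_add hb, Real.rpow_one] at h
    exact le_of_mul_le_mul_right h hb
  have h2 : (b ^ (-p)) ^ p⁻¹ ≤ L ^ p⁻¹ := Real.rpow_le_rpow (by positivity) h1 (by positivity)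
  rw [← Real.rpow_mul hb.le, neg_mul, mul_inv_cancel₀ hp.ne', Real.rpow_neg_one] at h2
  have h3 := mul_le_mul_of_nonneg_right h2 hb.le
  rwa [inv_mul_cancel₀ hb.ne'] at h3

/-- A lower set containing all singletons and of doubling at most `K` has density at least
`K ^ (-16 K)`. -/
lemma two_pow_card_le_of_isLowerSet [Fintype α] {𝒜 : Finset (Finset α)}
    (hl : IsLowerSet (𝒜 : Set (Finset α))) (h0 : ∅ ∈ 𝒜) (h1 : ∀ i, {i} ∈ 𝒜) {K : ℝ}
    (hK1 : 1 ≤ K) (hK : (#(image₂ (· ∆ ·) 𝒜 𝒜) : ℝ) ≤ K * #𝒜) :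
    (2 : ℝ) ^ Fintype.card α ≤ K ^ (16 * K) * #𝒜 := by
  have hK0 : 0 < K := by linarith
  have hN : (0 : ℝ) < #𝒜 := by exact_mod_cast card_pos.2 ⟨∅, h0⟩
  -- As `K` tends to 1 the bound leaves no room for constant losses; below `3 / 2` every coordinate
  -- has proportion at least `(2 - K) / 2 ≥ 1 / 4`, so none is discarded. Above, the losses `3 / 2 ≤
  -- K` and `2 ≤ K ^ 2` are absorbed: `12 * K` of the exponent comes from `J`, `4 * K` from its
  -- complement.
  rcases lt_or_ge K (3 / 2) with hK3 | hK3
  · have hJ : ∀ i ∈ (univ : Finset α), (4⁻¹ : ℝ) * #𝒜 ≤ #{s ∈ 𝒜 | i ∈ s} := by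
      intro i _
      have h2 : (2 : ℝ) * #𝒜 ≤ #(image₂ (· ∆ ·) 𝒜 𝒜) + 2 * #{s ∈ 𝒜 | i ∈ s} := by
        exact_mod_cast two_mul_card_le_card_image₂_add h0 (h1 i)
      nlinarith
    have hd : densityOn 𝒜 univ * 2 ^ Fintype.card α = #𝒜 := by
      simp [densityOn]
    have h2 := (pow_card_mul_densityOn_rpow_le hl h0 univ (by norm_num) hJ).trans hK
    rw [card_univ] at h2
    have h3 : densityOn 𝒜 univ ^ (1 - 4⁻¹ : ℝ) ≤ K * densityOn 𝒜 univ := by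
      rw [← hd] at h2
      refine le_of_mul_le_mul_left (h2.trans_eq ?_) (show (0 : ℝ) < 2 ^ Fintype.card α by positivity)
      ring
    have h4 := le_rpow_of_mul_rpow_le (densityOn_pos h0 _) (by norm_num) h3
    have h5 : K ^ (4⁻¹ : ℝ)⁻¹ ≤ K ^ (16 * K) :=
      Real.rpow_le_rpow_of_exponent_le hK1 (by norm_num; linarith)
    calc (2 : ℝ) ^ Fintype.card α ≤ 2 ^ Fintype.card α * (K ^ (4⁻¹ : ℝ)⁻¹ * densityOn 𝒜 univ) :=
          le_mul_of_one_le_right (by positivity) h4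
      _ = K ^ (4⁻¹ : ℝ)⁻¹ * #𝒜 := by rw [← hd]; ring
      _ ≤ _ := by gcongr
  · set J : Finset α := {i | (6 * K)⁻¹ * #𝒜 ≤ #{s ∈ 𝒜 | i ∈ s}} with hJdef
    have hJ : ∀ i ∈ J, (6 * K)⁻¹ * (#𝒜 : ℝ) ≤ #{s ∈ 𝒜 | i ∈ s} := fun i hi => by
      simpa [hJdef] using hi
    have hJc : ∀ i ∈ Jᶜ, (#{s ∈ 𝒜 | i ∈ s} : ℝ) < (6 * K)⁻¹ * #𝒜 := fun i hi => by
      simpa [hJdef] using hi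
    have hm := card_le_two_mul_of_forall_lt h1 hK1 hK Jᶜ hJc
    have hfe : ({s ∈ 𝒜 | Disjoint s Jᶜ} : Finset (Finset α)) = {s ∈ 𝒜 | s ⊆ J} := by
      ext s; simp [disjoint_compl_right_iff]
    have hB : (2 / 3 : ℝ) * #𝒜 ≤ #{s ∈ 𝒜 | s ⊆ J} := by
      have a2 : (#𝒜 : ℝ) ≤ #{s ∈ 𝒜 | Disjoint s Jᶜ} + ∑ i ∈ Jᶜ, (#{s ∈ 𝒜 | i ∈ s} : ℝ) := by
        exact_mod_cast card_le_card_filter_disjoint_add 𝒜 Jᶜ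
      have a3 : ∑ i ∈ Jᶜ, (#{s ∈ 𝒜 | i ∈ s} : ℝ) ≤ #Jᶜ * ((6 * K)⁻¹ * #𝒜) := by
        rw [← nsmul_eq_mul]
        exact sum_le_card_nsmul _ _ _ fun i hi => (hJc i hi).le
      have a4 : (#Jᶜ : ℝ) * ((6 * K)⁻¹ * #𝒜) ≤ 2 * K * ((6 * K)⁻¹ * #𝒜) := by gcongr
      have a5 : 2 * K * ((6 * K)⁻¹ * #𝒜) = (1 / 3 : ℝ) * #𝒜 := by field_simp; norm_num
      rw [hfe] at a2
      linarith
    have hd : densityOn 𝒜 J * 2 ^ #J = #{s ∈ 𝒜 | s ⊆ J} := by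
      simp [densityOn]
    have hp1 : (6 * K)⁻¹ ≤ 1 := inv_le_one_of_one_le₀ (by linarith)
    have h2 := (pow_card_mul_densityOn_rpow_le hl h0 J hp1 hJ).trans hK
    have h3 : densityOn 𝒜 J ^ (1 - (6 * K)⁻¹) ≤ K ^ 2 * densityOn 𝒜 J := by
      refine le_of_mul_le_mul_left (h2.trans ?_) (show (0 : ℝ) < 2 ^ #J by positivity)
      have : K * #𝒜 ≤ K ^ 2 * #{s ∈ 𝒜 | s ⊆ J} := by
        have : (#𝒜 : ℝ) ≤ K * #{s ∈ 𝒜 | s ⊆ J} := by nlinarith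
        nlinarith
      rw [← hd] at this
      linarith
    have h4 := le_rpow_of_mul_rpow_le (densityOn_pos h0 _) (by positivity) h3
    rw [inv_inv] at h4
    have h5 : (2 : ℝ) ^ #J ≤ (K ^ 2) ^ (6 * K) * #𝒜 :=
      calc (2 : ℝ) ^ #J ≤ 2 ^ #J * ((K ^ 2) ^ (6 * K) * densityOn 𝒜 J) :=
            le_mul_of_one_le_right (by positivity) h4
        _ = (K ^ 2) ^ (6 * K) * #{s ∈ 𝒜 | s ⊆ J} := by rw [← hd]; ring
        _ ≤ _ := by gcongr; exact filter_subset _ _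
    have h6 : (2 : ℝ) ^ #Jᶜ ≤ (K ^ 2) ^ (2 * K) :=
      calc (2 : ℝ) ^ #Jᶜ = (2 : ℝ) ^ (#Jᶜ : ℝ) := (Real.rpow_natCast _ _).symm
        _ ≤ 2 ^ (2 * K) := Real.rpow_le_rpow_of_exponent_le (by norm_num) hm
        _ ≤ _ := Real.rpow_le_rpow (by norm_num) (by nlinarith) (by positivity)
    have h7 : (K ^ 2) ^ (2 * K) * (K ^ 2) ^ (6 * K) = K ^ (16 * K) := by
      rw [← Real.rpow_add (by positivity), ← Real.rpow_natCast, ← Real.rpow_mul hK0.le]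
      congr 1; push_cast; ring
    rw [← card_compl_add_card J, pow_add, ← h7, mul_assoc]
    gcongr

end LowerSet

/-! ### Coordinates on the span over the two-element field -/

section Span
variable {G ι : Type*} [AddCommGroup G] [Module (ZMod 2) G] [DecidableEq ι]

lemma sum_symmDiff_of_zmod_two (v : ι → G) (S T : Finset ι) :
    ∑ i ∈ S ∆ T, v i = ∑ i ∈ S, v i + ∑ i ∈ T, v i := by
  have hchar : ∀ g : G, g + g = 0 := ZModModule.add_self
  have e1 : ∑ i ∈ S, v i = ∑ i ∈ S \ T, v i + ∑ i ∈ S ∩ T, v i := by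
    rw [add_comm, sum_inter_add_sum_sdiff]
  have e2 : ∑ i ∈ T, v i = ∑ i ∈ T \ S, v i + ∑ i ∈ S ∩ T, v i := by
    rw [add_comm, inter_comm, sum_inter_add_sum_sdiff]
  rw [e1, e2, symmDiff_def, sup_eq_union, sum_union disjoint_sdiff_sdiff, add_add_add_comm, hchar,
    add_zero]

lemma LinearIndependent.sum_injective_of_zmod_two {v : ι → G} (hv : LinearIndependent (ZMod 2) v) :
    Function.Injective fun S : Finset ι => ∑ i ∈ S, v i := by
  intro S T h
  have h0 : ∑ i ∈ S ∆ T, (1 : ZMod 2) • v i = 0 := by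
    simp only [one_smul, sum_symmDiff_of_zmod_two]
    rw [show ∑ i ∈ S, v i = ∑ i ∈ T, v i from h]
    exact ZModModule.add_self _
  have := linearIndependent_iff'.1 hv (S ∆ T) (fun _ => 1) h0
  rw [← symmDiff_eq_bot, bot_eq_empty, eq_empty_iff_forall_notMem]
  exact fun i hi => one_ne_zero (this i hi)

lemma span_range_eq_range_sum_of_zmod_two (v : ι → G) :
    (Submodule.span (ZMod 2) (Set.range v) : Set G) =
      Set.range fun S : Finset ι => ∑ i ∈ S, v i := by
  apply Set.Subset.antisymm
  · intro x hx
    induction hx using Submodule.span_induction with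
    | mem x hx =>
      obtain ⟨i, rfl⟩ := hx
      exact ⟨{i}, by simp⟩
    | zero => exact ⟨∅, by simp⟩
    | add x y _ _ hx hy =>
      obtain ⟨S, rfl⟩ := hx
      obtain ⟨T, rfl⟩ := hy
      exact ⟨S ∆ T, sum_symmDiff_of_zmod_two v S T⟩
    | smul c x _ hx =>
      obtain rfl | rfl : c = 0 ∨ c = 1 := by revert c; decide
      · exact ⟨∅, by simp⟩
      · simpa using hx
  · rintro _ ⟨S, rfl⟩
    exact Submodule.sum_mem _ fun i _ => Submodule.subset_span ⟨i, rfl⟩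

lemma finite_and_ncard_span_range_le_two_pow [Fintype ι] (v : ι → G) :
    (Submodule.span (ZMod 2) (Set.range v) : Set G).Finite ∧
      (Submodule.span (ZMod 2) (Set.range v) : Set G).ncard ≤ 2 ^ Fintype.card ι := by
  rw [span_range_eq_range_sum_of_zmod_two]
  refine ⟨Set.finite_range _, ?_⟩
  rw [← Set.image_univ]
  refine (Set.ncard_image_le Set.finite_univ).trans_eq ?_
  rw [Set.ncard_univ, Nat.card_eq_fintype_card, Fintype.card_finset]

/-- A set containing zero and of doubling at most `K` spans a subspace of size at most
`K ^ (16 K)` times its own. -/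
lemma ncard_span_le_of_card_add_le [DecidableEq G] (A : Finset G) (h0 : 0 ∈ A) {K : ℝ}
    (hK1 : 1 ≤ K) (hK : (#(A + A) : ℝ) ≤ K * #A) :
    (Submodule.span (ZMod 2) (A : Set G) : Set G).Finite ∧
      ((Submodule.span (ZMod 2) (A : Set G) : Set G).ncard : ℝ) ≤ K ^ (16 * K) * #A := by
  -- The basis lies in `A`, so all singletons belong to the family.
  obtain ⟨b, hbA, hbs, hbl⟩ := exists_linearIndependent (ZMod 2) (A : Set G)
  have : Fintype b := (A.finite_toSet.subset hbA).fintype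
  set φ : Finset b → G := fun S => ∑ i ∈ S, (i : G) with hφ
  have hinj : Function.Injective φ := hbl.sum_injective_of_zmod_two
  have hspan : Submodule.span (ZMod 2) (Set.range (Subtype.val : b → G)) =
      Submodule.span (ZMod 2) (A : Set G) := by rw [Subtype.range_coe, hbs]
  set 𝒜 : Finset (Finset b) := {S | φ S ∈ A} with h𝒜
  have hmem : ∀ S, S ∈ 𝒜 ↔ φ S ∈ A := by simp [h𝒜]
  have himage : 𝒜.image φ = A := by
    ext x
    simp only [mem_image, hmem]
    refine ⟨by rintro ⟨S, hS, rfl⟩; exact hS, fun hx => ?_⟩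
    have hx' : x ∈ (Submodule.span (ZMod 2) (Set.range (Subtype.val : b → G)) : Set G) := by
      rw [hspan]; exact Submodule.subset_span hx
    rw [span_range_eq_range_sum_of_zmod_two] at hx'
    obtain ⟨S, rfl⟩ := hx'
    exact ⟨S, hx, rfl⟩
  have hcard : #𝒜 = #A := by rw [← himage, card_image_of_injective _ hinj]
  have hsum : #(image₂ (· ∆ ·) 𝒜 𝒜) ≤ #(A + A) := by
    refine card_le_card_of_injOn φ ?_ hinj.injOn
    intro u hu
    obtain ⟨S, hS, T, hT, rfl⟩ := mem_image₂.1 hu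
    simp only [hφ, sum_symmDiff_of_zmod_two]
    exact mem_coe.2 (add_mem_add ((hmem S).1 hS) ((hmem T).1 hT))
  obtain ⟨ℬ, hl, hℬ0, hℬ1, hc, hs⟩ := exists_isLowerSet_card_image₂_symmDiff_le 𝒜
    ((hmem _).2 (by simpa [hφ] using h0)) fun i => (hmem _).2 (by simpa [hφ] using hbA i.2)
  have hfin := finite_and_ncard_span_range_le_two_pow (Subtype.val : b → G)
  rw [hspan] at hfin
  have hdoub : (#(image₂ (· ∆ ·) ℬ ℬ) : ℝ) ≤ K * #ℬ := by
    rw [hc, hcard]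
    exact le_trans (by exact_mod_cast hs.trans hsum) hK
  have := two_pow_card_le_of_isLowerSet hl hℬ0 hℬ1 hK1 hdoub
  rw [hc, hcard] at this
  exact ⟨hfin.1, le_trans (by exact_mod_cast hfin.2) this⟩

end Span

/-! ### The final bound -/

lemma rpow_mul_self_le_two_rpow {K : ℝ} (hK : 1 ≤ K) :
    K ^ (16 * K) ≤ 2 ^ (24 * K ^ ((3 : ℝ) / 2) * Real.log K) := by
  have hK0 : 0 < K := by linarith
  rw [Real.rpow_def_of_pos hK0, Real.rpow_def_of_pos two_pos, Real.exp_le_exp]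
  have h1 : K ≤ K ^ ((3 : ℝ) / 2) := Real.self_le_rpow_of_one_le hK (by norm_num)
  have h2 : (2 / 3 : ℝ) ≤ Real.log 2 := by linarith [Real.log_two_gt_d9]
  calc Real.log K * (16 * K) = (2 / 3) * (24 * K * Real.log K) := by ring
    _ ≤ Real.log 2 * (24 * K ^ ((3 : ℝ) / 2) * Real.log K) := by
      have := Real.log_nonneg hK
      gcongr

theorem theorem2 :
    ∃ C : ℝ, 0 < C ∧
      ∀ (G : Type u) [AddCommGroup G] [Module (ZMod 2) G] [DecidableEq G]
        (A : Finset G) (K : ℝ), A.Nonempty →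
        ((A + A).card : ℝ) ≤ K * (A.card : ℝ) →
        ∃ (V : Submodule (ZMod 2) G) (x : G),
          (A : Set G) ⊆ x +ᵥ (V : Set G) ∧
          (x +ᵥ (V : Set G)).Finite ∧
          ((x +ᵥ (V : Set G)).ncard : ℝ) ≤
            (2 : ℝ) ^ (C * K ^ ((3 : ℝ) / 2) * Real.log K) * (A.card : ℝ) := by
  -- `24 = 16 * (3 / 2)`, using `2 / 3 ≤ log 2` to pass to base 2.
  refine ⟨24, by norm_num, fun G _ _ _ A K hA hK => ?_⟩
  obtain ⟨a, ha⟩ := hA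
  have hN : (0 : ℝ) < #A := by exact_mod_cast card_pos.2 ⟨a, ha⟩
  have hK1 : 1 ≤ K := by
    have h : (#A : ℝ) ≤ #(A + A) := by exact_mod_cast card_le_card_add_left ⟨a, ha⟩
    exact le_of_mul_le_mul_right (by linarith) hN
  have hB : (#((-a +ᵥ A) + (-a +ᵥ A)) : ℝ) ≤ K * #(-a +ᵥ A) := by
    rw [vadd_add_vadd_comm, card_vadd_finset, card_vadd_finset]
    exact hK
  have h0 : 0 ∈ -a +ᵥ A := mem_vadd_finset.2 ⟨a, ha, by simp⟩
  obtain ⟨hfin, hle⟩ := ncard_span_le_of_card_add_le (-a +ᵥ A) h0 hK1 hB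
  rw [card_vadd_finset] at hle
  refine ⟨Submodule.span (ZMod 2) ((-a +ᵥ A : Finset G) : Set G), a, ?_, hfin.vadd_set, ?_⟩
  · intro x hx
    refine Set.mem_vadd_set.2 ⟨-a + x, Submodule.subset_span ?_, by simp⟩
    exact mem_coe.2 (mem_vadd_finset.2 ⟨x, hx, rfl⟩)
  · rw [Set.ncard_vadd_set]
    exact hle.trans (mul_le_mul_of_nonneg_right (rpow_mul_self_le_two_rpow hK1) hN.le)
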